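/- Let $\kappa$ be an uncountable regular cardinal. Give $\kappa^\kappa$ the bounded topology, generated by the sets $[\sigma]=\{x\in\kappa^\kappa:\sigma\subseteq x\}$ for $\sigma\in\kappa^{<\kappa}=\bigcup_{\alpha<\kappa}\kappa^\alpha$. An element $x\in\kappa^\kappa$ strongly dominates $f:\kappa^{<\kappa}\to\kappa$ if there is $\alpha_0<\kappa$ such that $x(\alpha)\ge f(x{\upharpoonright}\alpha)$ for all $\alpha$ with $\alpha_0<\alpha<\kappa$. A set $X\subseteq\kappa^\kappa$ is strongly dominating if every $f:\kappa^{<\kappa}\to\kappa$ is strongly dominated by some $x\in X$; let $\mathcal D_\kappa$ be the family of all $X\subseteq\kappa^\kappa$ that are not strongly dominating. A tree is a set $T\subseteq\kappa^{<\kappa}$ closed under initial segments, and $[T]=\{x\in\kappa^\kappa:\forall\alpha<\kappa\ (x{\upharpoonright}\alpha\in T)\}$. A tree $T$ is limit-closed if for every limit ordinal $\lambda<\kappa$ and every $\subseteq$-increasing sequence $\langle\sigma_\alpha:\alpha<\lambda\rangle$ of elements of $T$ we have $\bigcup_{\alpha<\lambda}\sigma_\alpha\in T$; it is pruned if every element of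 $T$ has a proper extension in $T$. A set is superclosed if it is of the form $[T]$ for some pruned limit-closed tree $T$. Then: 1. There is a closed strongly dominating set $C\subseteq\kappa^\kappa$ such that no subset of $C$ is both superclosed and strongly dominating. 2. Hence there is no collection $\mathbb P$ of pruned limit-closed trees such that $[T]\notin\mathcal D_\kappa$ for every $T\in\mathbb P$, and every closed set $C\subseteq\kappa^\kappa$ either belongs to $\mathcal D_\kappa$ or contains $[T]$ for some $T\in\mathbb P$. -/

import Mathlib

universe u

/-- The set `κ = {α : α < κ}` of all ordinals below the (initial ordinal of the) cardinal `κ`. -/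
abbrev Below (κ : Cardinal.{u}) : Type (u + 1) := Set.Iio κ.ord

/-- The underlying set `κ^κ` of the generalized Baire space: all functions from `κ` to `κ`. -/
def GenBaire (κ : Cardinal.{u}) : Type (u + 1) := Below κ → Below κ

/-- The set `κ^{<κ}` of all functions `σ : α → κ` for an ordinal `α < κ`; `α` is the length. -/
structure Node (κ : Cardinal.{u}) : Type (u + 1) where
  len : Below κ
  val : Set.Iio len → Below κ

namespace Node

variable {κ : Cardinal.{u}}

/-- The graph of `σ`, that is, `σ` as a set of ordered pairs. -/
def graph (σ : Node κ) : Set (Below κ × Below κ) :=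
  {p | ∃ h : p.1 < σ.len, σ.val ⟨p.1, h⟩ = p.2}

/-- `σ ⊆ τ`: `τ` extends `σ`, equivalently `σ` is an initial segment of `τ`. -/
def Sub (σ τ : Node κ) : Prop := σ.graph ⊆ τ.graph

end Node

namespace GenBaire

variable {κ : Cardinal.{u}}

/-- The restriction `x ↾ α`, a node of length `α`. -/
def restrict (x : GenBaire κ) (α : Below κ) : Node κ := ⟨α, fun β => x β.1⟩

/-- The basic open set `[σ] = {x ∈ κ^κ : σ ⊆ x}`. -/
def basicOpen (σ : Node κ) : Set (GenBaire κ) := {x | ∀ β : Set.Iio σ.len, x β.1 = σ.val β}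

/-- The bounded topology on `κ^κ`, generated by the sets `[σ]` for `σ ∈ κ^{<κ}`. -/
instance boundedTopology (κ : Cardinal.{u}) : TopologicalSpace (GenBaire κ) :=
  TopologicalSpace.generateFrom (Set.range basicOpen)

/-- `x` strongly dominates `f : κ^{<κ} → κ`: `x(α) ≥ f(x ↾ α)` for all `α` above some `α₀ < κ`. -/
def StronglyDominates (x : GenBaire κ) (f : Node κ → Below κ) : Prop :=
  ∃ α₀ : Below κ, ∀ α : Below κ, α₀ < α → f (x.restrict α) ≤ x α

end GenBaire

/-- A strongly dominating family: every `f : κ^{<κ} → κ` is strongly dominated by a member. -/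
def IsStronglyDominating {κ : Cardinal.{u}} (X : Set (GenBaire κ)) : Prop :=
  ∀ f : Node κ → Below κ, ∃ x ∈ X, x.StronglyDominates f

/-- The ideal `𝓓_κ` of all subsets of `κ^κ` that are not strongly dominating families. -/
def nonDominatingIdeal (κ : Cardinal.{u}) : Set (Set (GenBaire κ)) :=
  {X | ¬ IsStronglyDominating X}

/-- A tree in `κ^{<κ}`: a set of nodes that is closed under initial segments. -/
def IsTree {κ : Cardinal.{u}} (T : Set (Node κ)) : Prop :=
  ∀ τ ∈ T, ∀ σ : Node κ, σ.Sub τ → σ ∈ T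

/-- The set `[T]` of all branches of length `κ` through `T`. -/
def branches {κ : Cardinal.{u}} (T : Set (Node κ)) : Set (GenBaire κ) :=
  {x | ∀ α : Below κ, x.restrict α ∈ T}

/-- `T` contains the union of every `⊆`-increasing sequence `⟨σ_α : α < l⟩` of members of `T` whose
length `l < κ` is a limit ordinal. Here `τ` is the union `⋃_α σ_α` as a set of pairs; for regular
`κ` the union is always such a node `τ`, as `Node.exists_union` shows. -/
def IsLimitClosed {κ : Cardinal.{u}} (T : Set (Node κ)) : Prop :=
  ∀ l : Ordinal.{u}, l < κ.ord → Order.IsSuccLimit l →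
    ∀ s : Set.Iio l → Node κ, (∀ α, s α ∈ T) → (∀ α β, α ≤ β → (s α).Sub (s β)) →
      ∀ τ : Node κ, τ.graph = ⋃ α, (s α).graph → τ ∈ T

/-- `T` is pruned: every node in `T` has a proper extension in `T`. -/
def IsPruned {κ : Cardinal.{u}} (T : Set (Node κ)) : Prop :=
  ∀ σ ∈ T, ∃ τ ∈ T, σ.Sub τ ∧ σ ≠ τ

/-- A superclosed set: the set of branches of a pruned limit-closed tree. Without prunedness the
notion would collapse: adding to any tree all its branches of limit length `< κ` makes it
limit-closed and does not change its branches of length `κ`. -/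
def IsSuperclosed {κ : Cardinal.{u}} (C : Set (GenBaire κ)) : Prop :=
  ∃ T : Set (Node κ), IsTree T ∧ IsLimitClosed T ∧ IsPruned T ∧ C = branches T

/-- Unions of increasing sequences of length `< κ` exist in `κ^{<κ}` when `κ` is regular. -/
theorem Node.exists_union {κ : Cardinal.{u}} (hκ : κ.IsRegular) (l : Ordinal.{u})
    (hl : l < κ.ord) (s : Set.Iio l → Node κ) (hs : ∀ α β, α ≤ β → (s α).Sub (s β)) :
    ∃ τ : Node κ, τ.graph = ⋃ α, (s α).graph := by
  classical
  have hlt : (⨆ α, (s α).len.1) < κ.ord := by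
    refine Ordinal.lift_iSup_lt_of_lt_cof ?_ fun α => (s α).len.2
    rw [Cardinal.mk_Iio_ordinal, ← Ordinal.lift_cof, hκ.cof_ord]
    rw [Cardinal.lift_id'.{u, u + 1}, Cardinal.lift_lt]
    exact Cardinal.lt_ord.1 hl
  have hbdd : BddAbove (Set.range fun α => (s α).len.1) :=
    ⟨κ.ord, by rintro _ ⟨α, rfl⟩; exact (s α).len.2.le⟩
  have key : ∀ β : Set.Iio (⟨_, hlt⟩ : Below κ), ∃ α, β.1 < (s α).len := by
    intro β
    have h : β.1.1 < ⨆ α, (s α).len.1 := β.2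
    by_contra! hc
    exact absurd h (not_lt.2 (Ordinal.iSup_le fun α => hc α))
  choose a ha using key
  refine ⟨⟨⟨_, hlt⟩, fun β => (s (a β)).val ⟨β.1, ha β⟩⟩, ?_⟩
  ext ⟨p, q⟩
  simp only [Node.graph, Set.mem_iUnion, Set.mem_ofPred_eq]
  constructor
  · rintro ⟨h, e⟩
    exact ⟨a ⟨p, h⟩, ha ⟨p, h⟩, e⟩
  · rintro ⟨α, h, e⟩
    have hp : p < (⟨_, hlt⟩ : Below κ) :=
      lt_of_lt_of_le (show p.1 < (s α).len.1 from h) (le_ciSup hbdd α)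
    refine ⟨hp, ?_⟩
    have h2 := ha ⟨p, hp⟩
    rcases le_total α (a ⟨p, hp⟩) with hle | hle
    · obtain ⟨_, e'⟩ := hs _ _ hle (show (p, q) ∈ (s α).graph from ⟨h, e⟩)
      exact e'
    · obtain ⟨_, e'⟩ := hs _ _ hle
        (show (p, (s (a ⟨p, hp⟩)).val ⟨p, h2⟩) ∈ (s (a ⟨p, hp⟩)).graph from ⟨h2, rfl⟩)
      exact e'.symm.trans e

/-! Split the points of countable cofinality into two stationary sets, `S` and its complement there,
and cut `κ` into consecutive blocks of length `ω`. Let `C` consist of the `x` for which no block has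
the supremum of its values in `S`. A block is bounded in `κ`, so a violation shows in an initial
segment and `C` is closed. The engine is `MeetsClosurePoints.exists_isLUB_run`: a strategy for `ω`
moves that may always play above any prescribed bound can steer the supremum of its moves into any
stationary set of points of countable cofinality. Steering into the complement of `S` while staying
above `f` on every block shows that `C` is strongly dominating. Conversely, if `[T]` is strongly
dominating, some node at the start of a block is a dominating node, and each dominating node has
dominating one-step extensions with arbitrarily large last value. Steer these values into `S` along
one block: limit closure puts the union in `T`, prunedness extends it to a branch, and that branch
is outside `C`. Part 2 follows by applying the supposed family to `C`. -/

/-- `κ` is an uncountable regular cardinal. -/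
class IsUncountableRegular (κ : Cardinal.{u}) : Prop where
  isRegular : κ.IsRegular
  aleph0_lt : Cardinal.aleph0 < κ

namespace Below

open Cardinal Ordinal

/-! ### Bounds below a regular cardinal, and blocks of length `ω` -/

section Basic

variable {κ : Cardinal.{u}} [hκ : IsUncountableRegular κ]

theorem isSuccLimit_ord : Order.IsSuccLimit κ.ord :=
  Cardinal.isSuccLimit_ord hκ.isRegular.aleph0_le

theorem omega0_lt_ord : ω < κ.ord := by
  rw [← ord_aleph0]
  exact ord_lt_ord.2 hκ.aleph0_lt

/-- A family of fewer than `κ` elements of a regular cardinal `κ` is bounded. -/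
theorem exists_forall_le {ι : Type (u + 1)}
    (hι : #ι < Cardinal.lift.{u + 1} κ) (g : ι → Below κ) : ∃ ξ, ∀ i, g i ≤ ξ := by
  have hlt : (⨆ i, (g i).1) < κ.ord := by
    refine Ordinal.lift_iSup_lt_of_lt_cof ?_ fun i => (g i).2
    rwa [← Ordinal.lift_cof, hκ.isRegular.cof_ord, Cardinal.lift_id'.{u, u + 1}]
  have hbdd : BddAbove (Set.range fun i => (g i).1) :=
    ⟨κ.ord, by rintro _ ⟨i, rfl⟩; exact (g i).2.le⟩
  exact ⟨⟨_, hlt⟩, fun i => le_ciSup hbdd i⟩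

instance : NoMaxOrder (Below κ) where
  exists_gt a := ⟨⟨Order.succ a.1, isSuccLimit_ord.succ_lt a.2⟩, Order.lt_succ a.1⟩

instance : Nonempty (Below κ) := ⟨⟨0, omega0_pos.trans omega0_lt_ord⟩⟩

theorem exists_forall_lt {ι : Type (u + 1)}
    (hι : #ι < Cardinal.lift.{u + 1} κ) (g : ι → Below κ) : ∃ ξ, ∀ i, g i < ξ := by
  obtain ⟨ξ, hξ⟩ := exists_forall_le hι g
  obtain ⟨η, hη⟩ := exists_gt ξ
  exact ⟨η, fun i => (hξ i).trans_lt hη⟩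

theorem mk_Iic_lt (ξ : Below κ) : #(Set.Iic ξ) < Cardinal.lift.{u + 1} κ := by
  obtain ⟨η, hη⟩ := exists_gt ξ
  have h1 : #(Set.Iic ξ) ≤ #(Set.Iio η.1) :=
    mk_le_of_injective (f := fun a => ⟨a.1.1, lt_of_le_of_lt a.2 hη⟩) fun a b h =>
      Subtype.ext (Subtype.ext (Subtype.mk.inj h))
  refine h1.trans_lt ?_
  rw [Cardinal.mk_Iio_ordinal, Cardinal.lift_lt]
  exact lt_ord.1 η.2

theorem mk_nat_lt : #(ULift.{u + 1} ℕ) < Cardinal.lift.{u + 1} κ := by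
  simpa using hκ.aleph0_lt

theorem exists_forall_nat_lt (g : ℕ → Below κ) : ∃ ξ, ∀ n, g n < ξ := by
  obtain ⟨ξ, h⟩ := exists_forall_lt mk_nat_lt fun n : ULift.{u + 1} ℕ => g n.down
  exact ⟨ξ, fun n => h ⟨n⟩⟩

theorem mk_list_Iic_lt (ξ : Below κ) : #(List (Set.Iic ξ)) < Cardinal.lift.{u + 1} κ := by
  refine (mk_list_le_max _).trans_lt (max_lt ?_ (mk_Iic_lt ξ))
  rw [← lift_aleph0.{u + 1, u}, Cardinal.lift_lt]
  exact hκ.aleph0_lt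

theorem exists_isLUB_of_nat (g : ℕ → Below κ) : ∃ δ, IsLUB (Set.range g) δ := by
  obtain ⟨ξ, hξ⟩ := exists_forall_nat_lt g
  have hne : (upperBounds (Set.range g)).Nonempty :=
    ⟨ξ, by rintro _ ⟨n, rfl⟩; exact (hξ n).le⟩
  exact ⟨wellFounded_lt.min _ hne, wellFounded_lt.min_mem _ hne,
    fun b hb => wellFounded_lt.min_le hb⟩

theorem succ_val (α : Below κ) : (Order.succ α).1 = α.1 + 1 := by
  refine le_antisymm ?_ ?_
  · have h : α.1 + 1 < κ.ord := isSuccLimit_ord.succ_lt α.2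
    exact (Order.succ_le_of_lt (show α < ⟨_, h⟩ from Order.lt_succ α.1) :)
  · exact Order.succ_le_of_lt (show α.1 < (Order.succ α).1 from Order.lt_succ α)

/-- The ordinal `ω * μ + n`, that is, the `n`-th element of the `μ`-th block of length `ω`. -/
def block (μ : Below κ) (n : ℕ) : Below κ :=
  ⟨ω * μ.1 + n, isPrincipal_add_ord hκ.isRegular.aleph0_le
    (isPrincipal_mul_ord hκ.isRegular.aleph0_le omega0_lt_ord μ.2)
    ((natCast_lt_omega0 n).trans omega0_lt_ord)⟩

theorem block_succ (μ : Below κ) (n : ℕ) : block μ (n + 1) = Order.succ (block μ n) := by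
  apply Subtype.ext
  rw [succ_val]
  simp [block, add_assoc]

theorem block_mono (μ : Below κ) {m n : ℕ} (h : m ≤ n) : block μ m ≤ block μ n := by
  change ω * μ.1 + m ≤ ω * μ.1 + n
  gcongr

theorem exists_lt_block (α : Below κ) : ∃ μ, α < block μ 0 := by
  refine ⟨Order.succ α, ?_⟩
  change α.1 < ω * (Order.succ α).1 + (0 : ℕ)
  rw [succ_val]
  simpa using (lt_add_one α.1).trans_le (le_mul_of_one_le_left' one_lt_omega0.le)

/-- The index of the block that contains `α`. -/
noncomputable def blockIndex (α : Below κ) : Below κ :=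
  ⟨α.1 / ω, (div_le_of_le_mul (le_mul_of_one_le_left' one_lt_omega0.le)).trans_lt α.2⟩

omit hκ in
theorem exists_mod_omega0 (α : Below κ) : ∃ n : ℕ, α.1 % ω = n :=
  lt_omega0.1 (mod_lt _ omega0_ne_zero)

/-- The position of `α` in its block. -/
noncomputable def blockPos (α : Below κ) : ℕ := (exists_mod_omega0 α).choose

theorem block_blockIndex_blockPos (α : Below κ) : block (blockIndex α) (blockPos α) = α := by
  apply Subtype.ext
  change ω * (α.1 / ω) + (blockPos α : Ordinal) = α.1
  rw [blockPos, ← (exists_mod_omega0 α).choose_spec, div_add_mod]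

theorem blockIndex_block (μ : Below κ) (n : ℕ) : blockIndex (block μ n) = μ := by
  apply Subtype.ext
  change (ω * μ.1 + n) / ω = μ.1
  rw [mul_add_div _ omega0_ne_zero, div_eq_zero_of_lt (natCast_lt_omega0 n), add_zero]

theorem blockPos_block (μ : Below κ) (n : ℕ) : blockPos (block μ n) = n := by
  have h := (exists_mod_omega0 (block μ n)).choose_spec
  change (ω * μ.1 + n) % ω = _ at h
  rw [mul_add_mod_self, mod_eq_of_lt (natCast_lt_omega0 n)] at h
  exact (Nat.cast_injective h).symm

end Basic

/-! ### Stationary sets of points of countable cofinality -/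

section Stationary

variable {κ : Cardinal.{u}}

/-- `A` contains a point closed under any given function; for regular uncountable `κ` this is
stationarity of `A` (apart from the point `0`). -/
def MeetsClosurePoints (A : Set (Below κ)) : Prop :=
  ∀ F : Below κ → Below κ, ∃ δ ∈ A, ∀ ξ < δ, F ξ < δ

/-- The points of countable cofinality: those that are strict suprema of `ω`-sequences. -/
def countableCof (κ : Cardinal.{u}) : Set (Below κ) :=
  {δ | ∃ a : ℕ → Below κ, (∀ n, a n < δ) ∧ ∀ ξ < δ, ∃ n, ξ ≤ a n}

theorem exists_lt_of_mem_countableCof {δ : Below κ} (h : δ ∈ countableCof κ) : ∃ ξ, ξ < δ := by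
  obtain ⟨a, ha, -⟩ := h
  exact ⟨a 0, ha 0⟩

theorem exists_of_not_meetsClosurePoints {A : Set (Below κ)} (h : ¬ MeetsClosurePoints A) :
    ∃ F : Below κ → Below κ, ∀ δ ∈ A, ¬ ∀ ξ < δ, F ξ < δ := by
  by_contra hc
  refine h fun F => ?_
  by_contra hF
  exact hc ⟨F, fun δ hδ hcl => hF ⟨δ, hδ, hcl⟩⟩

/-- Closure under `max (F ξ) ζ` forces `ζ < δ` as soon as some `ξ` lies below `δ`; countable
cofinality excludes `δ = 0`. -/
theorem MeetsClosurePoints.exists_gt {A : Set (Below κ)} (hA : MeetsClosurePoints A)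
    (hc : A ⊆ countableCof κ) (F : Below κ → Below κ) (ζ : Below κ) :
    ∃ δ ∈ A, ζ < δ ∧ ∀ ξ < δ, F ξ < δ := by
  obtain ⟨δ, hδ, h⟩ := hA fun ξ => max (F ξ) ζ
  obtain ⟨ξ, hξ⟩ := exists_lt_of_mem_countableCof (hc hδ)
  exact ⟨δ, hδ, (le_max_right _ _).trans_lt (h ξ hξ),
    fun ξ hξ => (le_max_left _ _).trans_lt (h ξ hξ)⟩

variable [IsUncountableRegular κ]

theorem meetsClosurePoints_countableCof : MeetsClosurePoints (countableCof κ) := by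
  intro F
  have hG : ∀ ξ : Below κ, ∃ η, ξ < η ∧ ∀ ζ ≤ ξ, F ζ < η := fun ξ => by
    obtain ⟨η, hη⟩ := exists_forall_lt (mk_Iic_lt ξ) fun ζ => max (F ζ.1) ζ.1
    exact ⟨η, (le_max_right _ _).trans_lt (hη ⟨ξ, le_refl ξ⟩),
      fun ζ hζ => (le_max_left _ _).trans_lt (hη ⟨ζ, hζ⟩)⟩
  choose G hG1 hG2 using hG
  let a : ℕ → Below κ := fun n => G^[n] (Classical.arbitrary _)
  have hs : ∀ n, a (n + 1) = G (a n) := fun n => Function.iterate_succ_apply' _ _ _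
  obtain ⟨δ, hδ⟩ := exists_isLUB_of_nat a
  have hlt : ∀ n, a n < δ := fun n =>
    (hG1 (a n)).trans_le (hs n ▸ hδ.1 ⟨n + 1, rfl⟩)
  have hcof : ∀ ξ < δ, ∃ n, ξ ≤ a n := fun ξ hξ => by
    by_contra! hc
    exact (hδ.2 (by rintro _ ⟨n, rfl⟩; exact (hc n).le) : δ ≤ ξ).not_gt hξ
  refine ⟨δ, ⟨a, hlt, hcof⟩, fun ξ hξ => ?_⟩
  obtain ⟨n, hn⟩ := hcof ξ hξ
  exact (hG2 _ ξ hn).trans ((hs n).symm ▸ hlt (n + 1))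

/-- Fodor's pressing-down lemma. -/
theorem MeetsClosurePoints.exists_fiber {A : Set (Below κ)} (hA : MeetsClosurePoints A)
    (h : Below κ → Below κ) (hh : ∀ δ ∈ A, h δ < δ) :
    ∃ γ, MeetsClosurePoints {δ ∈ A | h δ = γ} := by
  by_contra! hc
  choose F hF using fun γ => exists_of_not_meetsClosurePoints (hc γ)
  -- Diagonal intersection: a point closed under `G` is closed under `F γ` for every `γ` below it.
  have hG : ∀ ξ : Below κ, ∃ η, ∀ p : Set.Iic ξ × Set.Iic ξ, F p.1 p.2 < η := fun ξ => by
    refine exists_forall_lt ?_ _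
    rw [mk_prod, Cardinal.lift_id]
    refine mul_lt_of_lt ?_ (mk_Iic_lt ξ) (mk_Iic_lt ξ)
    simpa using IsUncountableRegular.aleph0_lt.le
  choose G hG using hG
  obtain ⟨δ, hδ, hcl⟩ := hA G
  refine hF (h δ) δ ⟨hδ, rfl⟩ fun ξ hξ => ?_
  exact (hG (max (h δ) ξ) (⟨h δ, le_max_left (h δ) ξ⟩, ⟨ξ, le_max_right (h δ) ξ⟩)).trans
    (hcl _ (max_lt (hh δ hδ) hξ))

/-- The points of countable cofinality split into two stationary sets. -/
theorem exists_split_countableCof : ∃ S ⊆ countableCof κ,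
    MeetsClosurePoints S ∧ MeetsClosurePoints (countableCof κ \ S) := by
  -- Without a splitting, each fiber given by Fodor contains all points closed under some function.
  -- Hence all points closed under one `G` share the same cofinal sequence `γ`, which is impossible
  -- for two of them.
  by_contra! hc
  have ha : ∀ δ : Below κ, ∃ a : ℕ → Below κ, δ ∈ countableCof κ →
      (∀ n, a n < δ) ∧ ∀ ξ < δ, ∃ n, ξ ≤ a n := fun δ => by
    by_cases h : δ ∈ countableCof κ
    · exact h.imp fun _ h _ => h
    · exact ⟨fun _ => δ, fun h' => absurd h' h⟩
  choose a ha using ha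
  have hγ : ∀ n, ∃ γ, MeetsClosurePoints {δ ∈ countableCof κ | a δ n = γ} := fun n =>
    meetsClosurePoints_countableCof.exists_fiber (fun δ => a δ n) fun δ hδ => (ha δ hδ).1 n
  choose γ hγ using hγ
  have hF : ∀ n, ∃ F : Below κ → Below κ, ∀ δ ∈ countableCof κ, (∀ ξ < δ, F ξ < δ) →
      a δ n = γ n := fun n => by
    obtain ⟨F, hF⟩ := exists_of_not_meetsClosurePoints (hc _ (fun _ h => h.1) (hγ n))
    refine ⟨F, fun δ hδ hcl => ?_⟩
    by_contra hne
    exact hF δ ⟨hδ, fun h => hne h.2⟩ hcl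
  choose F hF using hF
  choose G hG using fun ξ => exists_forall_nat_lt fun n => F n ξ
  obtain ⟨δ₁, h₁, -, c₁⟩ := meetsClosurePoints_countableCof.exists_gt subset_rfl G
    (Classical.arbitrary _)
  obtain ⟨δ₂, h₂, hlt, c₂⟩ := meetsClosurePoints_countableCof.exists_gt subset_rfl G δ₁
  obtain ⟨n, hn⟩ := (ha δ₂ h₂).2 δ₁ hlt
  rw [hF n δ₂ h₂ fun ξ hξ => (hG ξ n).trans (c₂ ξ hξ),
    ← hF n δ₁ h₁ fun ξ hξ => (hG ξ n).trans (c₁ ξ hξ)] at hn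
  exact hn.not_gt ((ha δ₁ h₁).1 n)

/-- The list `[b (n - 1), …, b 0]`. -/
def history {α : Type*} (b : ℕ → α) : ℕ → List α
  | 0 => []
  | n + 1 => b n :: history b n

theorem exists_history_eq {α : Type*} (step : ℕ → List α → α) :
    ∃ b : ℕ → α, ∀ n, b n = step n (history b n) := by
  let H : ℕ → List α := fun n => Nat.rec [] (fun n l => step n l :: l) n
  have hH : ∀ n, H n = history (fun n => step n (H n)) n := fun n => by
    induction n with
    | zero => rfl
    | succ n ih => rw [history, ← ih]
  exact ⟨fun n => step n (H n), fun n => congrArg _ (hH n)⟩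

/-- A strategy that may always play arbitrarily large values can be run so that the supremum of the
values played lies in a given stationary set of points of countable cofinality. -/
theorem MeetsClosurePoints.exists_isLUB_run {A : Set (Below κ)} (hA : MeetsClosurePoints A)
    (hc : A ⊆ countableCof κ) (next : List (Below κ) → Below κ → Below κ)
    (hnext : ∀ l ξ, ξ ≤ next l ξ) :
    ∃ δ ∈ A, ∃ b c : ℕ → Below κ, (∀ n, b n = next (history b n) (c n)) ∧
      IsLUB (Set.range b) δ := by
  have hF : ∀ ξ : Below κ, ∃ η, ∀ l : List (Set.Iic ξ), ∀ ζ ≤ ξ,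
      next (l.map Subtype.val) ζ < η := fun ξ => by
    -- One list encodes the pair: its head is the bound `ζ`, its tail the history. The default `ξ`
    -- is used only for the empty list.
    have := exists_forall_lt (mk_list_Iic_lt ξ) fun l =>
      next (l.tail.map Subtype.val) ((l.head?.map Subtype.val).getD ξ)
    obtain ⟨η, hη⟩ := this
    exact ⟨η, fun l ζ hζ => by simpa using hη (⟨ζ, hζ⟩ :: l)⟩
  choose F hF using hF
  obtain ⟨δ, hδ, hcl⟩ := hA F
  obtain ⟨a, ha, hcof⟩ := hc hδ
  obtain ⟨b, hb⟩ := exists_history_eq fun n l => next l (a n)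
  have hhist : ∀ n, ∃ ξ < δ, ∀ η ∈ history b n, η ≤ ξ := by
    intro n
    induction n with
    | zero => exact ⟨a 0, ha 0, by simp [history]⟩
    | succ n ih =>
      obtain ⟨ξ, hξ, h⟩ := ih
      have hbn : b n < δ := by
        have h' := hF (max ξ (a n)) ((history b n).attach.map fun η =>
          ⟨η.1, (h η.1 η.2).trans (le_max_left _ _)⟩) (a n) (le_max_right _ _)
        rw [List.map_map] at h'
        change next (((history b n).attach.map Subtype.val)) _ < _ at h'
        rw [List.attach_map_subtype_val, ← hb] at h'
        exact h'.trans (hcl _ (max_lt hξ (ha n)))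
      refine ⟨max ξ (b n), max_lt hξ hbn, fun η hη => ?_⟩
      rcases List.mem_cons.1 hη with rfl | hη
      · exact le_max_right _ _
      · exact (h η hη).trans (le_max_left _ _)
  refine ⟨δ, hδ, b, a, hb, ?_, fun u hu => ?_⟩
  · rintro _ ⟨n, rfl⟩
    obtain ⟨ξ, hξ, h⟩ := hhist (n + 1)
    exact (h _ (by simp [history])).trans hξ.le
  · by_contra! hlt
    -- Cofinality gives only `≤`; aiming at `F u > u` instead of `u` makes the inequality strict.
    obtain ⟨n, hn⟩ := hcof (F u) (hcl u hlt)
    have h1 : b n ≤ u := hu ⟨n, rfl⟩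
    have h2 : a n ≤ b n := hb n ▸ hnext _ _
    have h3 := (hnext [] u).trans_lt (hF u [] u le_rfl)
    exact absurd (h3.trans_le (hn.trans (h2.trans h1))) (lt_irrefl _)

end Stationary

end Below

open Below

/-! ### Nodes and their finite extensions -/

namespace Node

variable {κ : Cardinal.{u}}

theorem ext_val {σ τ : Node κ} (hl : σ.len = τ.len)
    (hv : ∀ β (h : β < σ.len) (h' : β < τ.len), σ.val ⟨β, h⟩ = τ.val ⟨β, h'⟩) : σ = τ := by
  obtain ⟨l, v⟩ := σ
  obtain ⟨l', v'⟩ := τ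
  obtain rfl : l = l' := hl
  congr 1
  funext β
  exact hv β.1 β.2 β.2

theorem sub_iff {σ τ : Node κ} : σ.Sub τ ↔ ∃ hl : σ.len ≤ τ.len,
    ∀ β (h : β < σ.len), τ.val ⟨β, h.trans_le hl⟩ = σ.val ⟨β, h⟩ := by
  constructor
  · intro hs
    have h1 : ∀ β (h : β < σ.len), ∃ h' : β < τ.len, τ.val ⟨β, h'⟩ = σ.val ⟨β, h⟩ :=
      fun β h => hs (show (β, σ.val ⟨β, h⟩) ∈ σ.graph from ⟨h, rfl⟩)
    exact ⟨le_of_forall_lt fun β h => (h1 β h).1, fun β h => (h1 β h).2⟩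
  · rintro ⟨hl, hv⟩ ⟨p, q⟩ ⟨h, e⟩
    exact ⟨h.trans_le hl, (hv p h).trans e⟩

theorem Sub.trans {σ τ ρ : Node κ} (h : σ.Sub τ) (h' : τ.Sub ρ) : σ.Sub ρ :=
  Set.Subset.trans h h'

/-- The initial segment of length `α` of a node. -/
def truncate (σ : Node κ) (α : Below κ) (h : α ≤ σ.len) : Node κ :=
  ⟨α, fun β => σ.val ⟨β.1, lt_of_lt_of_le β.2 h⟩⟩

open Classical in
/-- The node `σ⌢ξ`. -/
noncomputable def snoc (σ : Node κ) (ξ : Below κ) : Node κ :=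
  ⟨Order.succ σ.len, fun β => if h : β.1 < σ.len then σ.val ⟨β.1, h⟩ else ξ⟩

/-- The extension of `σ` by a finite sequence, the most recent value being the head of the list. -/
noncomputable def append (σ : Node κ) : List (Below κ) → Node κ
  | [] => σ
  | ξ :: l => (append σ l).snoc ξ

theorem sub_snoc (σ : Node κ) (ξ : Below κ) : σ.Sub (σ.snoc ξ) :=
  sub_iff.2 ⟨Order.le_succ σ.len, fun _ h => dif_pos h⟩

theorem append_history_sub (σ : Node κ) (b : ℕ → Below κ) {m n : ℕ} (h : m ≤ n) :
    (σ.append (history b m)).Sub (σ.append (history b n)) := by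
  induction n, h using Nat.le_induction with
  | base => exact Set.Subset.rfl
  | succ n _ ih => exact ih.trans (sub_snoc _ _)

variable [IsUncountableRegular κ]

theorem mem_graph_snoc (σ : Node κ) (ξ : Below κ) : (σ.len, ξ) ∈ (σ.snoc ξ).graph :=
  ⟨Order.lt_succ σ.len, dif_neg (lt_irrefl _)⟩

theorem append_history_len (σ : Node κ) (b : ℕ → Below κ) {μ : Below κ} (h : σ.len = block μ 0)
    (n : ℕ) : (σ.append (history b n)).len = block μ n := by
  induction n with
  | zero => exact h
  | succ n ih => rw [block_succ, ← ih]; rfl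

end Node

/-! ### The closed strongly dominating set -/

namespace GenBaire

variable {κ : Cardinal.{u}}

theorem restrict_sub (x : GenBaire κ) {α β : Below κ} (h : α ≤ β) :
    (x.restrict α).Sub (x.restrict β) :=
  Node.sub_iff.2 ⟨h, fun _ _ => rfl⟩

/-- A point of `κ^κ` may be defined by transfinite recursion. -/
theorem exists_eq_apply_restrict (N : Node κ → Below κ) :
    ∃ x : GenBaire κ, ∀ α, x α = N (x.restrict α) := by
  let x : GenBaire κ := wellFounded_lt.fix fun α ih => N ⟨α, fun β => ih β.1 β.2⟩
  exact ⟨x, fun α => wellFounded_lt.fix_eq _ α⟩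

theorem mem_basicOpen_restrict (x : GenBaire κ) (α : Below κ) : x ∈ basicOpen (x.restrict α) :=
  fun _ => rfl

theorem isOpen_basicOpen (σ : Node κ) : IsOpen (basicOpen σ) :=
  TopologicalSpace.isOpen_generateFrom_of_mem ⟨σ, rfl⟩

variable [IsUncountableRegular κ]

theorem restrict_succ (x : GenBaire κ) (α : Below κ) :
    x.restrict (Order.succ α) = (x.restrict α).snoc (x α) := by
  refine Node.ext_val rfl fun β h _ => ?_
  change x β = dite _ _ _
  split_ifs with hβ
  · rfl
  · rw [le_antisymm (Order.lt_succ_iff.1 h) (not_lt.1 hβ)]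

theorem restrict_block (x : GenBaire κ) (μ : Below κ) (n : ℕ) :
    x.restrict (block μ n) =
      (x.restrict (block μ 0)).append (history (fun n => x (block μ n)) n) := by
  induction n with
  | zero => rfl
  | succ n ih => rw [block_succ, restrict_succ, ih]; rfl

/-- The set of all `x` for which no supremum of the values on a block lies in `S`. -/
def avoidBlockSups (S : Set (Below κ)) : Set (GenBaire κ) :=
  {x | ∀ μ, ∀ δ ∈ S, ¬ IsLUB (Set.range fun n => x (block μ n)) δ}

theorem isClosed_avoidBlockSups (S : Set (Below κ)) : IsClosed (avoidBlockSups S) := by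
  rw [← isOpen_compl_iff, isOpen_iff_forall_mem_open]
  intro x hx
  obtain ⟨μ, δ, hδ, h⟩ : ∃ μ, ∃ δ ∈ S, IsLUB (Set.range fun n => x (block μ n)) δ := by
    simpa only [avoidBlockSups, Set.mem_compl_iff, Set.mem_ofPred_eq, not_forall, not_not,
      exists_prop] using hx
  obtain ⟨α, hα⟩ := exists_forall_nat_lt (block μ)
  refine ⟨basicOpen (x.restrict α), fun y hy hyS => hyS μ δ hδ ?_, isOpen_basicOpen _,
    x.mem_basicOpen_restrict α⟩
  have : (fun n => y (block μ n)) = fun n => x (block μ n) :=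
    funext fun n => hy ⟨block μ n, hα n⟩
  rwa [this]

theorem isStronglyDominating_avoidBlockSups {S : Set (Below κ)}
    (hS : MeetsClosurePoints (countableCof κ \ S)) :
    IsStronglyDominating (avoidBlockSups S) := by
  classical
  intro f
  have hb : ∀ σ : Node κ, ∃ b : ℕ → Below κ, (∀ n, f (σ.append (history b n)) ≤ b n) ∧
      ∀ δ ∈ S, ¬ IsLUB (Set.range b) δ := fun σ => by
    obtain ⟨δ, hδ, b, c, hbc, hlub⟩ := hS.exists_isLUB_run Set.sdiff_subset
      (fun l ξ => max ξ (f (σ.append l))) fun _ _ => le_max_left _ _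
    refine ⟨b, fun n => (le_max_right _ _).trans_eq (hbc n).symm, fun δ' hδ' h => ?_⟩
    exact hδ.2 (hlub.unique h ▸ hδ')
  choose B hB1 hB2 using hb
  obtain ⟨x, hx⟩ := exists_eq_apply_restrict fun σ : Node κ =>
    -- The run for a block depends only on the restriction to the start of that block. The `else`
    -- value is never taken.
    if h : block (blockIndex σ.len) 0 ≤ σ.len then B (σ.truncate _ h) (blockPos σ.len)
    else σ.len
  have hxB : ∀ μ n, x (block μ n) = B (x.restrict (block μ 0)) n := fun μ n => by
    have h : block (blockIndex (block μ n)) 0 ≤ block μ n := by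
      rw [blockIndex_block]
      exact block_mono μ n.zero_le
    rw [hx (block μ n)]
    refine (dif_pos h).trans ?_
    change B (x.restrict (block (blockIndex (block μ n)) 0)) (blockPos (block μ n)) = _
    rw [blockIndex_block, blockPos_block]
  refine ⟨x, fun μ δ hδ => ?_, Classical.arbitrary _, fun α _ => ?_⟩
  · simp only [hxB]
    exact hB2 _ δ hδ
  · obtain ⟨μ, n, rfl⟩ : ∃ μ n, α = block μ n := ⟨_, _, (block_blockIndex_blockPos α).symm⟩
    rw [restrict_block, hxB]
    simp only [hxB]
    exact hB1 _ n

end GenBaire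

open Below GenBaire

/-! ### Dominating nodes in pruned limit-closed trees -/

namespace Node

variable {κ : Cardinal.{u}}

theorem exists_snoc_sub {σ τ : Node κ} (h : σ.Sub τ) (hne : σ ≠ τ) :
    ∃ ξ, (σ.snoc ξ).Sub τ := by
  obtain ⟨hl, hv⟩ := sub_iff.1 h
  have hlt : σ.len < τ.len := hl.lt_of_ne fun he =>
    hne (ext_val he fun β h1 _ => (hv β h1).symm)
  refine ⟨τ.val ⟨σ.len, hlt⟩, sub_iff.2 ⟨Order.succ_le_of_lt hlt, fun β hβ => ?_⟩⟩
  change _ = dite _ _ _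
  split_ifs with h'
  · exact hv β h'
  · have : β = σ.len := le_antisymm (Order.le_of_lt_succ hβ) (not_lt.1 h')
    subst this
    rfl

theorem apply_eq_of_mem_graph {x : GenBaire κ} {α β ξ : Below κ}
    (h : (β, ξ) ∈ (x.restrict α).graph) : x β = ξ := h.2

end Node

section Trees

variable {κ : Cardinal.{u}} [IsUncountableRegular κ]

/-- Every node of a pruned limit-closed tree lies on a branch. -/
theorem exists_mem_branches {T : Set (Node κ)} (hT : IsTree T) (hlim : IsLimitClosed T)
    (hpr : IsPruned T) {τ : Node κ} (hτ : τ ∈ T) : ∃ x ∈ branches T, x.restrict τ.len = τ := by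
  classical
  have hnx : ∀ σ : Node κ, ∃ ξ, σ ∈ T → σ.snoc ξ ∈ T := fun σ => by
    by_cases hσ : σ ∈ T
    · obtain ⟨ρ, hρ, hs, hne⟩ := hpr σ hσ
      obtain ⟨ξ, hξ⟩ := Node.exists_snoc_sub hs hne
      exact ⟨ξ, fun _ => hT ρ hρ _ hξ⟩
    · exact ⟨σ.len, fun h => absurd h hσ⟩
  choose nx hnx using hnx
  obtain ⟨x, hx⟩ := exists_eq_apply_restrict fun σ : Node κ =>
    if h : σ.len < τ.len then τ.val ⟨σ.len, h⟩ else nx σ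
  have hlow : ∀ α (h : α < τ.len), x α = τ.val ⟨α, h⟩ := fun α h => (hx α).trans (dif_pos h)
  have hhigh : ∀ α, ¬ α < τ.len → x α = nx (x.restrict α) := fun α h =>
    (hx α).trans (dif_neg h)
  have hxτ : x.restrict τ.len = τ := Node.ext_val rfl fun β h _ => hlow β h
  refine ⟨x, fun α => ?_, hxτ⟩
  induction α using WellFoundedLT.induction with
  | _ α ih =>
  by_cases hle : α ≤ τ.len
  · exact hT τ hτ _ (hxτ ▸ x.restrict_sub hle)
  rw [not_le] at hle
  rcases Ordinal.zero_or_succ_or_isSuccLimit α.1 with h0 | ⟨o, ho⟩ | hl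
  · exact absurd (show τ.len.1 < α.1 from hle) (by simp [h0])
  · have hoα : o < α.1 := ho ▸ Order.lt_succ o
    obtain ⟨β, rfl⟩ : ∃ β : Below κ, β.1 = o := ⟨⟨o, hoα.trans α.2⟩, rfl⟩
    have hα : α = Order.succ β := Subtype.ext (by
      rw [succ_val, ← ho, Order.succ_eq_add_one])
    subst hα
    rw [restrict_succ, hhigh β (not_lt.2 (Order.le_of_lt_succ hle))]
    exact hnx _ (ih β (Order.lt_succ β))
  · refine hlim α.1 α.2 hl (fun β => x.restrict ⟨β.1, (show β.1 < α.1 from β.2).trans α.2⟩)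
      (fun β => ih _ β.2) (fun β γ h => x.restrict_sub h) _ ?_
    ext ⟨p, q⟩
    simp only [Set.mem_iUnion]
    constructor
    · rintro ⟨h, e⟩
      have hp : (Order.succ p).1 < α.1 := succ_val p ▸ hl.succ_lt h
      exact ⟨⟨_, hp⟩, Order.lt_succ p, e⟩
    · rintro ⟨β, h, e⟩
      exact ⟨show p.1 < α.1 from lt_trans (show p.1 < β.1 from h) β.2, e⟩

/-- Above `σ`, every function is dominated everywhere by a branch of `T` through `σ`. -/
def IsDominatingNode (T : Set (Node κ)) (σ : Node κ) : Prop :=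
  ∀ f : Node κ → Below κ, ∃ x ∈ branches T, x.restrict σ.len = σ ∧
    ∀ α, σ.len ≤ α → f (x.restrict α) ≤ x α

omit [IsUncountableRegular κ] in
theorem IsDominatingNode.mem {T : Set (Node κ)} {σ : Node κ} (h : IsDominatingNode T σ) :
    σ ∈ T := by
  obtain ⟨x, hx, hσ, -⟩ := h fun _ => σ.len
  exact hσ ▸ hx σ.len

/-- Otherwise each node at a block start has a refuting function. Let `f τ` bound, at `τ`, those of
the fewer than `κ` initial segments of `τ`. A branch strongly dominating `f` then contradicts the
refutation at a block start past its threshold. -/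
theorem exists_isDominatingNode {T : Set (Node κ)} (hT : IsStronglyDominating (branches T)) :
    ∃ μ, ∃ σ : Node κ, σ.len = block μ 0 ∧ IsDominatingNode T σ := by
  by_contra! hc
  have hF : ∀ σ : Node κ, ∃ f : Node κ → Below κ, ∀ μ, σ.len = block μ 0 →
      ∀ x ∈ branches T, x.restrict σ.len = σ → ∃ α, σ.len ≤ α ∧ x α < f (x.restrict α) :=
    fun σ => by
    by_cases h : ∃ μ, σ.len = block μ 0
    · obtain ⟨μ, hμ⟩ := h
      have := hc μ σ hμ
      simp only [IsDominatingNode, not_forall] at this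
      obtain ⟨f, hf⟩ := this
      refine ⟨f, fun _ _ x hx hσ => ?_⟩
      by_contra! h'
      exact hf ⟨x, hx, hσ, h'⟩
    · exact ⟨fun _ => σ.len, fun μ hμ => absurd ⟨μ, hμ⟩ h⟩
  choose F hF using hF
  choose f hf using fun τ : Node κ => exists_forall_le (mk_Iic_lt τ.len) fun β =>
    F (τ.truncate β.1 β.2) τ
  obtain ⟨x, hx, α₀, hdom⟩ := hT f
  obtain ⟨μ, hμ⟩ := exists_lt_block α₀
  obtain ⟨α, hα, hlt⟩ := hF (x.restrict (block μ 0)) μ rfl x hx rfl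
  exact (hlt.trans_le (hf (x.restrict α) ⟨block μ 0, hα⟩)).not_ge (hdom α (hμ.trans_le hα))

theorem IsDominatingNode.exists_snoc {T : Set (Node κ)} {σ : Node κ} (h : IsDominatingNode T σ)
    (ξ : Below κ) : ∃ η, ξ ≤ η ∧ IsDominatingNode T (σ.snoc η) := by
  classical
  by_contra! hc
  have hF : ∀ η, ∃ f : Node κ → Below κ, ξ ≤ η → ∀ x ∈ branches T,
      x.restrict (σ.snoc η).len = σ.snoc η →
        ∃ α, (σ.snoc η).len ≤ α ∧ x α < f (x.restrict α) := fun η => by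
    by_cases hη : ξ ≤ η
    · have := hc η hη
      simp only [IsDominatingNode, not_forall] at this
      obtain ⟨f, hf⟩ := this
      refine ⟨f, fun _ x hx hσ => ?_⟩
      by_contra! h'
      exact hf ⟨x, hx, hσ, h'⟩
    · exact ⟨fun _ => ξ, fun h => absurd h hη⟩
  choose F hF using hF
  -- The refuting functions are glued along the value at `σ.len`; the value `ξ` at `σ` itself forces
  -- `ξ ≤ x σ.len`.
  obtain ⟨x, hx, hσ, hdom⟩ := h fun τ =>
    if h : σ.len < τ.len then F (τ.val ⟨σ.len, h⟩) τ else ξ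
  have h0 : ξ ≤ x σ.len := (dif_neg (lt_irrefl σ.len)).ge.trans (hdom σ.len le_rfl)
  have hs : x.restrict (Order.succ σ.len) = σ.snoc (x σ.len) := by rw [restrict_succ, hσ]
  obtain ⟨α, hα, hlt⟩ := hF _ h0 x hx hs
  have hlen : σ.len < α := (Order.lt_succ σ.len).trans_le hα
  exact hlt.not_ge ((dif_pos hlen).ge.trans (hdom α hlen.le))

/-- A strongly dominating superclosed set has an element with a block supremum in any given
stationary set of points of countable cofinality. -/
theorem not_branches_subset_avoidBlockSups {S : Set (Below κ)} (hc : S ⊆ countableCof κ)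
    (hS : MeetsClosurePoints S) {T : Set (Node κ)} (hT : IsTree T) (hlim : IsLimitClosed T)
    (hpr : IsPruned T) (hdom : IsStronglyDominating (branches T)) :
    ¬ branches T ⊆ avoidBlockSups S := by
  intro hsub
  obtain ⟨μ, σ, hlen, hσ⟩ := exists_isDominatingNode hdom
  have hnext : ∀ l ξ, ∃ η, ξ ≤ η ∧
      (IsDominatingNode T (σ.append l) → IsDominatingNode T ((σ.append l).snoc η)) := by
    intro l ξ
    by_cases h : IsDominatingNode T (σ.append l)
    · exact (h.exists_snoc ξ).imp fun η hη => ⟨hη.1, fun _ => hη.2⟩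
    · exact ⟨ξ, le_rfl, fun h' => absurd h' h⟩
  choose next hle hnext using hnext
  obtain ⟨δ, hδ, b, c, hb, hlub⟩ := hS.exists_isLUB_run hc next hle
  have hgood : ∀ n, IsDominatingNode T (σ.append (history b n)) := fun n => by
    induction n with
    | zero => exact hσ
    | succ n ih =>
      have := hnext _ (c n) ih
      rw [← hb n] at this
      exact this
  choose k hk using fun β : Set.Iio Ordinal.omega0.{u} => Ordinal.lt_omega0.1 β.2
  let s : Set.Iio Ordinal.omega0.{u} → Node κ := fun β => σ.append (history b (k β))
  have hmono : ∀ β γ, β ≤ γ → (s β).Sub (s γ) := fun β γ h => by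
    refine Node.append_history_sub _ _ ?_
    have : β.1 ≤ γ.1 := h
    rw [hk β, hk γ] at this
    exact_mod_cast this
  obtain ⟨τ, hτ⟩ := Node.exists_union IsUncountableRegular.isRegular _ omega0_lt_ord s hmono
  have hτT : τ ∈ T := hlim _ omega0_lt_ord Ordinal.isSuccLimit_omega0 s
    (fun β => (hgood _).mem) hmono τ hτ
  obtain ⟨x, hx, hxτ⟩ := exists_mem_branches hT hlim hpr hτT
  have hxb : ∀ n, x (block μ n) = b n := fun n => by
    refine Node.apply_eq_of_mem_graph (α := τ.len) ?_
    rw [hxτ, hτ]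
    -- The index is `n + 1` because `b n` is the last entry of the node extended by `n + 1` moves.
    refine Set.mem_iUnion.2 ⟨⟨((n + 1 : ℕ) : Ordinal), Ordinal.natCast_lt_omega0 _⟩, ?_⟩
    have hkn : k ⟨((n + 1 : ℕ) : Ordinal), Ordinal.natCast_lt_omega0 _⟩ = n + 1 :=
      (Nat.cast_injective (hk ⟨((n + 1 : ℕ) : Ordinal), Ordinal.natCast_lt_omega0 _⟩)).symm
    simp only [s, hkn]
    rw [← Node.append_history_len σ b hlen n]
    exact Node.mem_graph_snoc _ _
  refine hsub hx μ δ hδ ?_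
  simpa only [hxb] using hlub

end Trees

theorem corollary4p6 (κ : Cardinal.{u}) (hreg : κ.IsRegular) (hunc : Cardinal.aleph0 < κ) :
    (∃ C : Set (GenBaire κ), IsClosed C ∧ IsStronglyDominating C ∧
      ¬ ∃ D : Set (GenBaire κ), D ⊆ C ∧ IsSuperclosed D ∧ IsStronglyDominating D) ∧
    ¬ ∃ P : Set (Set (Node κ)),
      (∀ T ∈ P, IsTree T ∧ IsLimitClosed T ∧ IsPruned T) ∧
      (∀ T ∈ P, branches T ∉ nonDominatingIdeal κ) ∧
      (∀ C : Set (GenBaire κ), IsClosed C →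
        C ∈ nonDominatingIdeal κ ∨ ∃ T ∈ P, branches T ⊆ C) := by
  have : IsUncountableRegular κ := ⟨hreg, hunc⟩
  obtain ⟨S, hc, hS, hS'⟩ := exists_split_countableCof (κ := κ)
  have hclosed := isClosed_avoidBlockSups S
  have hdom := isStronglyDominating_avoidBlockSups hS'
  refine ⟨⟨_, hclosed, hdom, ?_⟩, ?_⟩
  · rintro ⟨_, hsub, ⟨T, hT, hlim, hpr, rfl⟩, hD⟩
    exact not_branches_subset_avoidBlockSups hc hS hT hlim hpr hD hsub
  · rintro ⟨P, hP, hPD, hall⟩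
    rcases hall _ hclosed with h | ⟨T, hTP, hsub⟩
    · exact h hdom
    · obtain ⟨hT, hlim, hpr⟩ := hP T hTP
      exact not_branches_subset_avoidBlockSups hc hS hT hlim hpr
        (not_not.1 (hPD T hTP)) hsub
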